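/- **Objects.** The integer window stream $\mathcal W_k$ of size $k\in\mathbb N$ has states $\mathbb N^k$, initial state $(0,\dots,0)$, and inputs $r$ and $w(v)$ ($v\in\mathbb N$). The write $w(v)$ changes $(q_1,\dots,q_k)$ into $(q_2,\dots,q_k,v)$ and returns $\bot$; the read $r$ leaves the state unchanged and returns it. $\mathcal W_k^K$ is the array of $K$ independent copies of $\mathcal W_k$, with inputs $\mathrm{read}(x)$ and $\mathrm{write}(x,v)$, $0\le x<K$. The sequential specification $L(T)$ of a type $T$ is the set of finite or infinite words over operations $\sigma_i/\sigma_o$ and hidden operations $\sigma_i$ (output unknown) obtained from the infinite operation sequences labelling runs of $T$ from its initial state by possibly hiding outputs and possibly truncating. **Causal convergence.** A history $H$ is a countable set $E$ of events labelled by operations, with a partial order $\mapsto$ (program order) in which each event has a finite past. A causal order is a partial order $\to$ on $E$ that contains $\mapsto$ and such that $\{e' : e\not\to e'\}$ is finite for every $e\in E$. $H$ is *causally convergent* for $T$ if there are a causal order $\to$ and a total order $\le$ containing $\to$ such that, for every $e\in E$, some word of $L(T)$ lists the labels of the events of $\lfloor e\rfloor=\{e' : e'\to e\}$ in the order $\le$,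 with the outputs of all events other than $e$ hidden. **System.** There are $n$ asynchronous sequential processes $p_0,\dots,p_{n-1}$, which may crash (a crashed process takes no more steps; a process that never crashes is non-faulty). They communicate by reliable causal broadcast: only messages broadcast earlier are received, each at most once by each process; a process that broadcasts a message receives it immediately, as part of the same step; if some process receives a message, then every non-faulty process eventually receives it; and if a process broadcasts $m$ after receiving $m'$, then every process that receives $m$ has received $m'$ before. An execution is a finite or infinite interleaving of steps of the processes. Its history consists of the calls made to $\mathrm{read}$ and $\mathrm{write}$, labelled by input and return value, where $e\mapsto e'$ if $e=e'$ or $e$ occurs before $e'$ on the same process. **Algorithm.** Process $p_i$ has a clock $vtime_i\in\mathbb N$, initially $0$, and an array $str_i$ of $K$ streams of $k$ cells $(v,(vt,j))$, initially $(0,(0,0))$. Timestamps $(vt,j)$ are compared lexicographically. * $\mathrm{read}(x)$ returns the values of the cells $str_i[x][0],\dots,str_i[x][k-1]$, without the timestamps. * $\mathrm{write}(x,v)$ broadcasts $\mathrm{Mess}(x,v,vtime_i+1,i)$ and returns $\bot$. * On receiving $\mathrm{Mess}(x,v,vt,j)$: $vtime_i\leftarrow\max(vtime_i,vt)$; $y\leftarrow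 0$; while $y<k$ and the timestamp of $str_i[x][y]$ is $\le(vt,j)$, do $str_i[x][y]\leftarrow str_i[x][y+1]$ (omitted if $y=k-1$) and $y\leftarrow y+1$; then, if $y\neq0$, $str_i[x][y-1]\leftarrow(v,(vt,j))$. **Proposition.** For all $n,K,k\in\mathbb N$, every history admitted by this algorithm, i.e. every history of an execution of it on $n$ processes (up to renaming of the events), is causally convergent for $\mathcal W_k^K$. -/

import Mathlib

/-! ### Sequential objects -/

/-- An abstract data type with input alphabet `I`, output alphabet `O` and set of states `Q`:
a transducer with total transition and output functions. -/
structure ADT (I O Q : Type) where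
  countable_input : Countable I
  countable_output : Countable O
  countable_state : Countable Q
  init : Q
  trans : Q → I → Q
  out : Q → I → O

/-- The labels of events: operations `i / o`, and hidden operations, of which only the input
is known. -/
inductive Op (I O : Type) where
  | op (i : I) (o : O) : Op I O
  | hidden (i : I) : Op I O

theorem Op.countable {I O : Type} (hI : Countable I) (hO : Countable O) : Countable (Op I O) := by
  let f : Op I O → (I × O) ⊕ I := fun a => match a with
    | .op i o => .inl (i, o)
    | .hidden i => .inr i
  have hf : Function.Injective f := by
    intro a b h
    cases a <;> cases b <;> simp_all [f]
  exact hf.countable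

/-- The label without its output. -/
def Op.hide {I O : Type} : Op I O → Op I O
  | .op i _ => .hidden i
  | .hidden i => .hidden i

/-- A finite or infinite word: its letters are indexed by the natural numbers below `len`. -/
structure SeqWord (A : Type) where
  len : ℕ∞
  letter : {m : ℕ // (m : ℕ∞) < len} → A

/-- An infinite sequence of operations labels a path of the transducer from its initial state. -/
def ADT.Recognizes {I O Q : Type} (T : ADT I O Q) (u : ℕ → I × O) : Prop :=
  ∃ q : ℕ → Q, q 0 = T.init ∧
    ∀ m, T.trans (q m) (u m).1 = q (m + 1) ∧ T.out (q m) (u m).1 = (u m).2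

/-- The sequential specification `L(T)`. -/
def ADT.seqSpec {I O Q : Type} (T : ADT I O Q) : Set (SeqWord (Op I O)) :=
  {w | ∃ u : ℕ → I × O, T.Recognizes u ∧
    ∀ m, w.letter m = Op.op (u m).1 (u m).2 ∨ w.letter m = Op.hidden (u m).1}

/-! ### Distributed histories -/

/-- A distributed history: countably many labelled events, partially ordered by the program order
`prog`, each event having a finite past. -/
structure History (I O : Type) where
  Event : Type
  countable_event : Countable Event
  countable_op : Countable (Op I O)
  label : Event → Op I O
  prog : Event → Event → Prop
  prog_partialOrder : IsPartialOrder Event prog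
  finite_past : ∀ e, {e' | prog e' e}.Finite

namespace History

variable {I O : Type}

/-- The linearizations of `H`: words that list the labels of all events, where no event comes
after one of its successors in the program order (as `prog` is reflexive, no event is repeated). -/
def linearizations (H : History I O) : Set (SeqWord (Op I O)) :=
  {w | ∃ enum : {m : ℕ // (m : ℕ∞) < w.len} → H.Event,
    Function.Surjective enum ∧ (∀ i j, i < j → ¬ H.prog (enum j) (enum i)) ∧
    ∀ i, w.letter i = H.label (enum i)}

open Classical in
/-- The projection `H.π(A, B)`: keep the events of `A`, and hide the outputs of the events that are
not in `B`. -/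
noncomputable def proj (H : History I O) (A B : Set H.Event) : History I O where
  Event := A
  countable_event := by
    have := H.countable_event
    infer_instance
  countable_op := H.countable_op
  label e := if (e : H.Event) ∈ B then H.label e else (H.label e).hide
  prog e e' := H.prog e e'
  prog_partialOrder :=
    { refl := fun e => H.prog_partialOrder.refl e
      trans := fun a b c => H.prog_partialOrder.trans a b c
      antisymm := fun a b h h' => Subtype.ext (H.prog_partialOrder.antisymm a b h h') }
  finite_past e := (H.finite_past e).preimage Subtype.val_injective.injOn

/-- The history with the same labelled events, ordered by `r`. -/
def withOrder (H : History I O) (r : H.Event → H.Event → Prop) (hr : IsPartialOrder H.Event r)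
    (hfin : ∀ e, {e' | r e' e}.Finite) : History I O where
  Event := H.Event
  countable_event := H.countable_event
  countable_op := H.countable_op
  label := H.label
  prog := r
  prog_partialOrder := hr
  finite_past := hfin

/-- Causal orders: partial orders that contain the program order and in which every event precedes
all but finitely many events. -/
structure IsCausalOrder (H : History I O) (r : H.Event → H.Event → Prop) : Prop where
  partialOrder : IsPartialOrder H.Event r
  contains_prog : ∀ e e', H.prog e e' → r e e'
  cofinite : ∀ e, {e' | ¬ r e e'}.Finite

/-- A total order `le` that contains the relation `r`. -/
structure IsTotalExtension {E : Type} (r le : E → E → Prop) : Prop where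
  linearOrder : IsLinearOrder E le
  contains : ∀ e e', r e e' → le e e'

/-- Events have a finite past in a total order that contains a causal order, so that the order may
serve as a program order. -/
theorem IsTotalExtension.finite_past {H : History I O} {r le : H.Event → H.Event → Prop}
    (hle : IsTotalExtension r le) (hr : H.IsCausalOrder r) (e : H.Event) :
    {e' | le e' e}.Finite := by
  refine ((hr.cofinite e).insert e).subset ?_
  intro e' h
  by_cases h' : e' = e
  · exact Or.inl h'
  · exact Or.inr fun hc => h' (hle.linearOrder.antisymm _ _ h (hle.contains _ _ hc))

/-- Causal convergence of the history `H` for the abstract data type `T`: for some causal order `r`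
and some total order `le` containing it, every event `e` is explained by a linearization, in the
order `le`, of its causal past, where only the output of `e` itself is visible. -/
def CausallyConvergent {Q : Type} (T : ADT I O Q) (H : History I O) : Prop :=
  ∃ (r le : H.Event → H.Event → Prop) (hr : H.IsCausalOrder r) (hle : IsTotalExtension r le),
    ∀ e : H.Event,
      (((H.withOrder le hle.linearOrder.toIsPartialOrder (hle.finite_past hr)).proj
        {e' | r e' e} {e}).linearizations ∩ T.seqSpec).Nonempty

/-- `H` and `H'` are the same history up to the names of the events. -/
def Isomorphic (H H' : History I O) : Prop :=
  ∃ f : H.Event ≃ H'.Event, (∀ e, H'.label (f e) = H.label e) ∧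
    ∀ e e', H'.prog (f e) (f e') ↔ H.prog e e'

end History

/-! ### Arrays of window streams -/

/-- The inputs of a window stream. -/
inductive WInput where
  | read : WInput
  | write (v : ℕ) : WInput

theorem WInput.countable : Countable WInput := by
  let f : WInput → Option ℕ := fun a => match a with
    | .read => none
    | .write v => some v
  have hf : Function.Injective f := by
    intro a b h
    cases a <;> cases b <;> simp_all [f]
  exact hf.countable

/-- The integer window stream of size `k`. The output `⊥` of a write is `none`. -/
def windowStream (k : ℕ) : ADT WInput (Option (Fin k → ℕ)) (Fin k → ℕ) where
  countable_input := WInput.countable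
  countable_output := inferInstance
  countable_state := inferInstance
  init := fun _ => 0
  trans q a := match a with
    | .read => q
    | .write v => fun y => if h : y.val + 1 < k then q ⟨y.val + 1, h⟩ else v
  out q a := match a with
    | .read => some q
    | .write _ => none

/-- The array of `K` independent copies of `T`; the input `(x, a)` is the input `a` on the copy of
index `x`. -/
def ADT.array {I O Q : Type} (K : ℕ) (T : ADT I O Q) : ADT (Fin K × I) O (Fin K → Q) where
  countable_input := by
    have := T.countable_input
    infer_instance
  countable_output := T.countable_output
  countable_state := by
    have := T.countable_state
    infer_instance
  init := fun _ => T.init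
  trans q a := Function.update q a.1 (T.trans (q a.1) a.2)
  out q a := T.out (q a.1) a.2

/-! ### The algorithm: code of one process -/

/-- A cell of a local stream: a value, and the timestamp (logical time, process id) of the write
that proposed it. Timestamps are compared lexicographically. -/
structure Cell where
  val : ℕ
  ts : ℕ ×ₗ ℕ

/-- The message `Mess(x, v, vt, j)`. -/
structure Mess (K : ℕ) where
  x : Fin K
  v : ℕ
  vt : ℕ
  j : ℕ

/-- The variables of a process: its Lamport clock and its array of `K` streams of `k` cells. -/
structure LocalState (K k : ℕ) where
  vtime : ℕ
  str : Fin K → Fin k → Cell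

def LocalState.init (K k : ℕ) : LocalState K k where
  vtime := 0
  str := fun _ _ => ⟨0, toLex (0, 0)⟩

/-- `if y ≠ 0 then a[y - 1] ← c`. -/
def storeBefore {k : ℕ} (c : Cell) (a : Fin k → Cell) (y : ℕ) : Fin k → Cell :=
  if h : y ≠ 0 ∧ y - 1 < k then Function.update a ⟨y - 1, h.2⟩ c else a

/-- The insertion of the cell `c` in a stream, from the value `y` of the loop counter on:
`while y < k ∧ a[y].ts ≤ c.ts do { a[y] ← a[y + 1]; y ← y + 1 }; if y ≠ 0 then a[y - 1] ← c`.
There is nothing to shift into the last cell, which is then overwritten with `c`. -/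
def insertLoop {k : ℕ} (c : Cell) (a : Fin k → Cell) (y : ℕ) : Fin k → Cell :=
  if hy : y < k then
    if (a ⟨y, hy⟩).ts ≤ c.ts then
      insertLoop c (if h : y + 1 < k then Function.update a ⟨y, hy⟩ (a ⟨y + 1, h⟩) else a) (y + 1)
    else storeBefore c a y
  else storeBefore c a y
termination_by k - y

/-- `on receive Mess(x, v, vt, j)`. -/
def LocalState.onReceive {K k : ℕ} (s : LocalState K k) (μ : Mess K) : LocalState K k where
  vtime := max s.vtime μ.vt
  str := Function.update s.str μ.x (insertLoop ⟨μ.v, toLex (μ.vt, μ.j)⟩ (s.str μ.x) 0)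

/-- The message that process `i` broadcasts in a call of `write(x, v)`. -/
def LocalState.writeMess {K k : ℕ} (s : LocalState K k) (i : ℕ) (x : Fin K) (v : ℕ) : Mess K :=
  ⟨x, v, s.vtime + 1, i⟩

/-- The value returned by a call: the values of the cells of the stream, without the timestamps,
for `read(x)`; nothing for `write(x, v)`. -/
def LocalState.returnValue {K k : ℕ} (s : LocalState K k) :
    Fin K × WInput → Option (Fin k → ℕ)
  | (x, .read) => some fun y => (s.str x y).val
  | (_, .write _) => none

/-! ### Executions in the asynchronous message-passing system -/

/-- A step of the system of `n` processes. A call of an operation by a process is one step; a call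
of `write` comprises the broadcast of a message and its immediate local reception. In
`receive i m`, process `i` receives the message broadcast at step number `m`. -/
inductive SysStep (n K : ℕ) where
  | idle : SysStep n K
  | crash (i : Fin n) : SysStep n K
  | call (i : Fin n) (a : Fin K × WInput) : SysStep n K
  | receive (i : Fin n) (m : ℕ) : SysStep n K

/-- The process that takes the step. -/
def SysStep.proc? {n K : ℕ} : SysStep n K → Option (Fin n)
  | .idle => none
  | .crash i => some i
  | .call i _ => some i
  | .receive i _ => some i

/-- The process and the input of a call. -/
def SysStep.call? {n K : ℕ} : SysStep n K → Option (Fin n × (Fin K × WInput))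
  | .call i a => some (i, a)
  | _ => none

/-- In the sequence of steps `step`, process `i` broadcasts a message at step number `m`. -/
def BroadcastsAt {n K : ℕ} (step : ℕ → SysStep n K) (i : Fin n) (m : ℕ) : Prop :=
  ∃ x v, step m = .call i (x, .write v)

/-- Process `i` receives at step number `t` the message broadcast at step number `m`: its own
message, received at once, or a message delivered by the network. -/
def ReceivesAt {n K : ℕ} (step : ℕ → SysStep n K) (i : Fin n) (m t : ℕ) : Prop :=
  (t = m ∧ BroadcastsAt step i m) ∨ step t = .receive i m

/-- A process is non-faulty if it never crashes. -/
def NonFaulty {n K : ℕ} (step : ℕ → SysStep n K) (i : Fin n) : Prop :=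
  ∀ t, step t ≠ .crash i

/-- An execution of the system: an interleaving of the steps of the processes, where crashed
processes take no more steps and the broadcast is reliable and causal. Finite executions are those
that end with idle steps. -/
structure Execution (n K : ℕ) where
  step : ℕ → SysStep n K
  crash_stops : ∀ i s t, step s = .crash i → s < t → (step t).proc? ≠ some i
  receive_broadcast : ∀ i m t, step t = .receive i m → m < t ∧ ∃ j, BroadcastsAt step j m
  receive_once : ∀ i m t t', ReceivesAt step i m t → ReceivesAt step i m t' → t = t'
  reliable : ∀ i m t, ReceivesAt step i m t →
    ∀ j, NonFaulty step j → ∃ t', ReceivesAt step j m t'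
  causal : ∀ i m m' s, BroadcastsAt step i m → ReceivesAt step i m' s → s < m →
    ∀ j t, ReceivesAt step j m t → ∃ t', t' < t ∧ ReceivesAt step j m' t'

/-- A global configuration: the local states of the processes, and the messages broadcast so far,
named by the number of the step at which they were broadcast. -/
structure Config (n K k : ℕ) where
  loc : Fin n → LocalState K k
  sent : ℕ → Option (Mess K)

def Config.init (n K k : ℕ) : Config n K k where
  loc := fun _ => LocalState.init K k
  sent := fun _ => none

/-- The effect of the step number `t`. -/
def Config.next {n K k : ℕ} (c : Config n K k) (t : ℕ) : SysStep n K → Config n K k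
  | .call i (x, .write v) =>
      let μ := (c.loc i).writeMess i x v
      { loc := Function.update c.loc i ((c.loc i).onReceive μ)
        sent := Function.update c.sent t (some μ) }
  | .receive i m =>
      match c.sent m with
      | some μ =>
          { loc := Function.update c.loc i ((c.loc i).onReceive μ)
            sent := c.sent }
      | none => c
  | _ => c

namespace Execution

variable {n K : ℕ}

/-- The configuration before the step number `t`, when all processes run the algorithm. -/
def config (ex : Execution n K) (k : ℕ) : ℕ → Config n K k
  | 0 => Config.init n K k
  | t + 1 => (ex.config k t).next t (ex.step t)

/-- The calls made during the execution, named by the number of their step. -/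
def Call (ex : Execution n K) : Type := {t : ℕ // (ex.step t).call?.isSome}

def caller (ex : Execution n K) (e : ex.Call) : Fin n := ((ex.step e.1).call?.get e.2).1

def input (ex : Execution n K) (e : ex.Call) : Fin K × WInput := ((ex.step e.1).call?.get e.2).2

/-- The history of the execution: its calls, labelled by their inputs and return values, and ordered
on each process by their occurrence. -/
def history (ex : Execution n K) (k : ℕ) : History (Fin K × WInput) (Option (Fin k → ℕ)) where
  Event := ex.Call
  countable_event := Subtype.countable
  countable_op := Op.countable ((windowStream k).array K).countable_input inferInstance
  label e := .op (ex.input e) (((ex.config k e.1).loc (ex.caller e)).returnValue (ex.input e))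
  prog e e' := ex.caller e = ex.caller e' ∧ e.1 ≤ e'.1
  prog_partialOrder :=
    { refl := fun _ => ⟨rfl, le_rfl⟩
      trans := fun _ _ _ h h' => ⟨h.1.trans h'.1, h.2.trans h'.2⟩
      antisymm := fun _ _ h h' => Subtype.ext (le_antisymm h.2 h'.2) }
  finite_past e := by
    refine ((Set.finite_Iic e.1).preimage (f := fun c : ex.Call => c.1)
      Subtype.val_injective.injOn).subset ?_
    exact fun e' h => h.2

end Execution

/-- The histories admitted by the algorithm for `K` window streams of size `k` on `n` processes. -/
def AdmittedByAlgorithm (n K k : ℕ) (H : History (Fin K × WInput) (Option (Fin k → ℕ))) : Prop :=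
  ∃ ex : Execution n K, H.Isomorphic (ex.history k)

/-! Two facts carry the proof: at any time the local stream `x` holds the last `k` cells, in
timestamp order, of all messages received for `x`, padded with zero cells
(`exists_str_eq_foldl_push`); and the writes in the causal past of a read are exactly the messages
its caller has received (`causallyLe_iff_mem_known`).

The causal order compares sets of received messages and, in addition, step numbers. Causal broadcast
makes the reception of a write's message imply the reception of everything its author had received.
Reliability, and the absence of calls after a crash, put all but finitely many calls above a given
one (`finite_not_causallyLe`).

The total order sorts calls by Lamport clock at their end. This clock is the largest logical time
received, or zero, so it is monotone in the set of received messages, and a write increases it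
strictly. Among calls with equal clocks, writes are sorted by process and come before reads. Hence
the order extends causality and sorts writes by timestamp.

Replaying the causal past of a read in this order therefore pushes the same values, in the same
order, as those held by the local stream. Reads in that past are harmless: their outputs are hidden
and they leave the state unchanged. -/

/-! ### From a sort key to causal convergence -/

theorem foldl_eq_of_forall_getElem {A Q : Type} (f : Q → A → Q) (l : List A) (a : ℕ → A)
    (q : ℕ → Q) (hq : ∀ m, q (m + 1) = f (q m) (a m)) (ha : ∀ m (h : m < l.length), a m = l[m]) :
    q l.length = l.foldl f (q 0) := by
  induction l using List.reverseRecOn with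
  | nil => rfl
  | append_singleton l b ih =>
    rw [List.foldl_append, List.length_append, List.length_singleton, hq, ih]
    · rw [ha l.length (by simp)]
      simp
    · intro m h
      rw [ha m (by simp; omega), List.getElem_append_left h]

/-- A causal order and an injective key that is monotone for it witness causal convergence, as soon
as every output is the one computed after the rest of the causal past, sorted by key. -/
theorem History.causallyConvergent_of_sorted {I O Q α : Type} [LinearOrder α] (T : ADT I O Q)
    (H : History I O) (r : H.Event → H.Event → Prop) (hr : H.IsCausalOrder r)
    (key : H.Event → α) (hinj : Function.Injective key)
    (hmono : ∀ e e', r e e' → key e ≤ key e') (inp : H.Event → I) (o : H.Event → O)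
    (hlabel : ∀ e, H.label e = .op (inp e) (o e))
    (h : ∀ e (l : List H.Event), l.Pairwise (fun a b => key a < key b) →
      (∀ e', e' ∈ l ↔ r e' e ∧ e' ≠ e) →
      T.out (l.foldl (fun q a => T.trans q (inp a)) T.init) (inp e) = o e) :
    H.CausallyConvergent T := by
  classical
  have hlin : IsLinearOrder H.Event (fun a b => key a ≤ key b) :=
    { refl := fun _ => le_rfl
      trans := fun _ _ _ => le_trans
      antisymm := fun _ _ h h' => hinj (le_antisymm h h')
      total := fun _ _ => le_total _ _ }
  have hle : History.IsTotalExtension r (fun a b => key a ≤ key b) := ⟨hlin, hmono⟩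
  refine ⟨r, _, hr, hle, fun e => ?_⟩
  have hfin : {e' | r e' e ∧ e' ≠ e}.Finite :=
    (hle.finite_past hr e).subset fun e' he' => hmono _ _ he'.1
  obtain ⟨l, hl, hmem⟩ : ∃ l : List H.Event, l.Pairwise (fun a b => key a < key b) ∧
      ∀ e', e' ∈ l ↔ r e' e ∧ e' ≠ e := by
    let _ : LinearOrder H.Event := LinearOrder.lift' key hinj
    refine ⟨hfin.toFinset.sort (· ≤ ·), ?_, fun e' => by simp⟩
    exact Finset.sortedLT_sort _ |>.pairwise
  -- The order extends causality, so `e` is the last event of its own past: the only visible output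
  -- is the last letter.
  set l' := l ++ [e] with hl'
  have hlen : l'.length = l.length + 1 := by simp [hl']
  have hl's : l'.Pairwise (fun a b => key a < key b) := by
    rw [hl', List.pairwise_append]
    refine ⟨hl, List.pairwise_singleton _ _, fun a ha b hb => ?_⟩
    rw [List.mem_singleton] at hb
    subst hb
    have := (hmem a).1 ha
    exact lt_of_le_of_ne (hmono _ _ this.1) fun hc => this.2 (hinj hc)
  have hmem' : ∀ e', e' ∈ l' ↔ r e' e := by
    intro e'
    rw [hl', List.mem_append, hmem, List.mem_singleton]
    by_cases he : e' = e
    · simp [he, hr.partialOrder.refl]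
    · simp [he]
  have hlast : l'[l.length]'(by omega) = e := by simp [hl']
  have hlt : ∀ m (hm : m < l.length), l'[m]'(by omega) = l[m] := fun m hm => by
    simp [hl', List.getElem_append_left hm]
  -- Words of the specification truncate infinite runs; repeating `e` beyond the end is an arbitrary
  -- continuation.
  let a : ℕ → H.Event := fun m => if hm : m < l'.length then l'[m] else e
  let q : ℕ → Q := fun m => Nat.rec T.init (fun m s => T.trans s (inp (a m))) m
  have hq : q l.length = l.foldl (fun q a => T.trans q (inp a)) T.init := by
    refine foldl_eq_of_forall_getElem (fun q a => T.trans q (inp a)) l a q (fun _ => rfl) ?_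
    intro m hm
    simp only [a]
    rw [dif_pos (by omega), hlt m hm]
  refine ⟨⟨(l'.length : ℕ), fun m => if m.1 = l.length then .op (inp e) (o e)
    else .hidden (inp (a m))⟩, ⟨fun m => ⟨l'[m.1]'(Nat.cast_lt.1 m.2), ?_⟩, ?_, ?_, ?_⟩,
    fun m => (inp (a m), T.out (q m) (inp (a m))), ⟨q, rfl, fun m => ⟨rfl, rfl⟩⟩, ?_⟩
  · exact (hmem' _).1 (List.getElem_mem _)
  · rintro ⟨e', he'⟩
    obtain ⟨m, hm, rfl⟩ := List.getElem_of_mem ((hmem' e').2 he')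
    exact ⟨⟨m, Nat.cast_lt.2 hm⟩, rfl⟩
  · intro i j hij
    have := List.pairwise_iff_getElem.1 hl's i.1 j.1 (Nat.cast_lt.1 i.2) (Nat.cast_lt.1 j.2) hij
    exact not_le.2 this
  · rintro ⟨m, hm⟩
    have hm : m < l'.length := Nat.cast_lt.1 hm
    change (if m = l.length then _ else _) =
      if l'[m] ∈ ({e} : Set H.Event) then H.label l'[m] else (H.label l'[m]).hide
    by_cases hml : m = l.length
    · subst hml
      rw [if_pos rfl, hlast, if_pos (Set.mem_singleton e), hlabel]
    · have h1 : m < l.length := by omega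
      have h2 : a m = l[m] := by
        simp only [a]
        rw [dif_pos hm, hlt m h1]
      have h3 := ((hmem l[m]).1 (List.getElem_mem _)).2
      rw [if_neg hml, hlt m h1, if_neg (show l[m] ∉ ({e} : Set H.Event) from h3), hlabel, ← h2]
      rfl
  · rintro ⟨m, hm⟩
    have hm : m < l'.length := Nat.cast_lt.1 hm
    change (if m = l.length then _ else _) = _ ∨ (if m = l.length then _ else _) = _
    by_cases hml : m = l.length
    · subst hml
      left
      have h2 : a l.length = e := by
        simp only [a]
        rw [dif_pos hm, hlast]
      change _ = Op.op (inp (a l.length)) (T.out (q l.length) (inp (a l.length)))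
      rw [if_pos rfl, hq, h2, h e l hl hmem]
    · right
      rw [if_neg hml]

/-! ### Window streams as iterated pushes -/

/-- A stream after the arrival of `c`: the oldest item is dropped. -/
def push {A : Type} {k : ℕ} (a : Fin k → A) (c : A) : Fin k → A :=
  fun y => if h : y.val + 1 < k then a ⟨y.val + 1, h⟩ else c

theorem comp_push {A B : Type} {k : ℕ} (f : A → B) (a : Fin k → A) (c : A) :
    f ∘ push a c = push (f ∘ a) (f c) := by
  funext y
  simp only [push, Function.comp]
  split_ifs <;> rfl

theorem comp_foldl_push {A B : Type} {k : ℕ} (f : A → B) (l : List A) (a : Fin k → A) :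
    f ∘ l.foldl push a = (l.map f).foldl push (f ∘ a) := by
  induction l generalizing a with
  | nil => rfl
  | cons c l ih => rw [List.foldl_cons, ih, comp_push, List.map_cons, List.foldl_cons]

/-- The value that an input of the array writes in the stream `x`. -/
def writtenValue {K : ℕ} (x : Fin K) : Fin K × WInput → Option ℕ
  | (_, .read) => none
  | (x', .write v) => if x' = x then some v else none

/-- Copies are independent and a write on a copy is a `push`, so only the values written to `x`
matter. -/
theorem array_foldl_trans {K k : ℕ} (x : Fin K) (l : List (Fin K × WInput))
    (q : Fin K → Fin k → ℕ) :
    l.foldl ((windowStream k).array K).trans q x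
      = (l.filterMap (writtenValue x)).foldl push (q x) := by
  induction l generalizing q with
  | nil => rfl
  | cons a l ih =>
    rw [List.foldl_cons, ih]
    obtain ⟨x', _ | v⟩ := a
    · rw [List.filterMap_cons_none rfl]
      congr 1
      by_cases h : x = x'
      · subst h
        exact Function.update_self ..
      · exact Function.update_of_ne h ..
    · by_cases h : x = x'
      · subst h
        rw [List.filterMap_cons_some (b := v) (by simp [writtenValue]), List.foldl_cons]
        congr 1
        exact Function.update_self ..
      · rw [List.filterMap_cons_none (by simp [writtenValue, Ne.symm h])]
        congr 1
        exact Function.update_of_ne h ..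

/-! ### The insertion loop on sorted streams -/

/-- The result of the insertion of `c` in a sorted stream. -/
def insertSorted {k : ℕ} (c : Cell) (a : Fin k → Cell) : Fin k → Cell := fun i =>
  if (a i).ts ≤ c.ts then
    if h : i.val + 1 < k then if (a ⟨i.val + 1, h⟩).ts ≤ c.ts then a ⟨i.val + 1, h⟩ else c else c
  else a i

/-- Loop invariant: `b` is the current array and `a` the original one; the cells below `y` have been
shifted and the others are untouched. It says nothing of the last cell once that cell has been
passed, since it is about to be overwritten. -/
theorem insertLoop_eq_insertSorted_of_shifted {k : ℕ} (c : Cell) (a : Fin k → Cell)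
    (ha : ∀ i j, i ≤ j → (a i).ts ≤ (a j).ts) (b : Fin k → Cell) (y : ℕ) (hyk : y ≤ k)
    (hlow : ∀ i : Fin k, i.val < y → (a i).ts ≤ c.ts)
    (hshift : ∀ i : Fin k, ∀ h : i.val + 1 < k, i.val < y → b i = a ⟨i.val + 1, h⟩)
    (hhigh : ∀ i : Fin k, y ≤ i.val → b i = a i) :
    insertLoop c b y = insertSorted c a := by
  -- Exit from the loop: by sortedness all cells from `y` on exceed `c`, and cell `y - 1`, whose old
  -- content is shifted or dropped, receives `c`.
  have hstore : (∀ h : y < k, ¬ (a ⟨y, h⟩).ts ≤ c.ts) → storeBefore c b y = insertSorted c a := by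
    intro hy
    funext i
    have hgt : ∀ j : Fin k, y ≤ j.val → ¬ (a j).ts ≤ c.ts := fun j hj hc =>
      hy (by omega) ((ha ⟨y, by omega⟩ j hj).trans hc)
    simp only [insertSorted]
    by_cases hi : i.val < y
    · rw [if_pos (hlow i hi), storeBefore, dif_pos (by omega)]
      by_cases hi' : i.val = y - 1
      · have : i = ⟨y - 1, by omega⟩ := Fin.ext hi'
        rw [← this, Function.update_self]
        split_ifs with h1 h2
        · exact absurd h2 (hgt _ (by simp; omega))
        · rfl
        · rfl
      · rw [Function.update_of_ne (fun hc => hi' (congrArg Fin.val hc)), dif_pos (by omega),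
          if_pos (hlow _ (by simp; omega)), hshift i (by omega) hi]
    · rw [if_neg (hgt i (by omega)), ← hhigh i (by omega), storeBefore]
      split_ifs with h
      · rw [Function.update_of_ne]
        intro hc
        have := congrArg Fin.val hc
        simp at this
        omega
      · rfl
  rw [insertLoop]
  split_ifs with hy hc h
  · rw [hhigh ⟨y, hy⟩ le_rfl] at hc
    apply insertLoop_eq_insertSorted_of_shifted c a ha _ (y + 1) hy
    · intro i hi
      exact (ha i ⟨y, hy⟩ (Nat.lt_succ_iff.1 hi)).trans hc
    · intro i hik hi
      by_cases hiy : i.val = y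
      · have : i = ⟨y, hy⟩ := Fin.ext hiy
        subst this
        rw [Function.update_self, hhigh _ (by simp)]
      · rw [Function.update_of_ne (fun hc => hiy (congrArg Fin.val hc))]
        exact hshift i hik (by omega)
    · intro i hi
      rw [Function.update_of_ne (fun hc => by have := congrArg Fin.val hc; simp at this; omega)]
      exact hhigh i (by omega)
  -- Here `y` is the last index: nothing is shifted, and the shift condition is vacuous at `y`.
  · rw [hhigh ⟨y, hy⟩ le_rfl] at hc
    apply insertLoop_eq_insertSorted_of_shifted c a ha _ (y + 1) hy
    · intro i hi
      exact (ha i ⟨y, hy⟩ (Nat.lt_succ_iff.1 hi)).trans hc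
    · intro i hik hi
      exact hshift i hik (by omega)
    · intro i hi
      exact hhigh i (by omega)
  · apply hstore
    intro _
    rwa [← hhigh ⟨y, hy⟩ le_rfl]
  · exact hstore fun h => absurd h hy
termination_by k - y

theorem insertLoop_eq_insertSorted {k : ℕ} (c : Cell) (a : Fin k → Cell)
    (ha : ∀ i j, i ≤ j → (a i).ts ≤ (a j).ts) : insertLoop c a 0 = insertSorted c a :=
  insertLoop_eq_insertSorted_of_shifted c a ha a 0 (Nat.zero_le _) (fun _ h => absurd h (by omega))
    (fun _ _ h => absurd h (by omega)) fun _ _ => rfl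

theorem insertSorted_eq_push {k : ℕ} (c : Cell) (a : Fin k → Cell)
    (h : ∀ i, (a i).ts ≤ c.ts) : insertSorted c a = push a c := by
  funext i
  simp [insertSorted, push, h]

/-- The newer cell `d` stops the insertion just as the end of the stream would, so `c` meets the
remaining cells of `a` as before, one place to the left. -/
theorem insertSorted_push {k : ℕ} (c d : Cell) (a : Fin k → Cell) (hcd : c.ts < d.ts) :
    insertSorted c (push a d) = push (insertSorted c a) d := by
  funext i
  have hcd' := not_le.2 hcd
  by_cases h1 : i.val + 1 < k
  · by_cases h2 : i.val + 1 + 1 < k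
    · simp [insertSorted, push, h1, h2]
    · simp [insertSorted, push, h1, h2, hcd']
  · simp [insertSorted, push, h1, hcd']

/-- The initial content of a stream. -/
def zeroCells (k : ℕ) : Fin k → Cell := fun _ => ⟨0, toLex (0, 0)⟩

theorem ts_foldl_push_le {k : ℕ} (L : List Cell) (c : Cell) (h : ∀ d ∈ L, d.ts ≤ c.ts)
    (a : Fin k → Cell) (ha : ∀ i, (a i).ts ≤ c.ts) (i : Fin k) :
    (L.foldl push a i).ts ≤ c.ts := by
  induction L generalizing a with
  | nil => exact ha i
  | cons d L ih =>
    refine ih (fun d hd => h d (List.mem_cons_of_mem _ hd)) _ fun j => ?_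
    simp only [push]
    split_ifs
    · exact ha _
    · exact h d List.mem_cons_self

theorem ts_zeroCells_le {k : ℕ} (c : Cell) (i : Fin k) : (zeroCells k i).ts ≤ c.ts :=
  Prod.Lex.le_iff.2 (by
    change 0 < (ofLex c.ts).1 ∨ 0 = (ofLex c.ts).1 ∧ 0 ≤ (ofLex c.ts).2
    omega)

/-- The zero cells carry the least timestamp, so padding a sorted list with them keeps it sorted. -/
theorem monotone_ts_foldl_push {k : ℕ} (L : List Cell)
    (hL : L.Pairwise (fun c d => c.ts < d.ts)) (i j : Fin k) (hij : i ≤ j) :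
    (L.foldl push (zeroCells k) i).ts ≤ (L.foldl push (zeroCells k) j).ts := by
  induction L using List.reverseRecOn generalizing i j with
  | nil => exact le_rfl
  | append_singleton L d ih =>
    rw [List.pairwise_append] at hL
    have hij' : i.val ≤ j.val := hij
    rw [List.foldl_append, List.foldl_cons, List.foldl_nil]
    by_cases hj : j.val + 1 < k
    · simp only [push, dif_pos hj, dif_pos (show i.val + 1 < k by omega)]
      exact ih hL.1 _ _ (by simpa using hij)
    · simp only [push, dif_neg hj]
      split_ifs
      · exact ts_foldl_push_le L d (fun c hc => (hL.2.2 c hc d (by simp)).le) _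
          (ts_zeroCells_le d) _
      · exact le_rfl

/-- The insertion in a stream that holds the last cells of a sorted list. -/
theorem insertLoop_foldl_push {k : ℕ} (c : Cell) (L : List Cell)
    (hL : L.Pairwise (fun c d => c.ts < d.ts)) (hc : ∀ d ∈ L, c.ts ≠ d.ts) :
    ∃ L' : List Cell, L'.Pairwise (fun c d => c.ts < d.ts) ∧ (∀ d, d ∈ L' ↔ d = c ∨ d ∈ L) ∧
      insertLoop c (L.foldl push (zeroCells k)) 0 = L'.foldl push (zeroCells k) := by
  rw [insertLoop_eq_insertSorted _ _ (monotone_ts_foldl_push L hL)]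
  induction L using List.reverseRecOn with
  | nil =>
    exact ⟨[c], List.pairwise_singleton _ _, fun d => by simp,
      insertSorted_eq_push _ _ (ts_zeroCells_le c)⟩
  | append_singleton L d ih =>
    have hL' := List.pairwise_append.1 hL
    have hLd : ∀ b ∈ L, b.ts < d.ts := fun b hb => hL'.2.2 b hb d (by simp)
    -- Either `c` goes below the newest cell `d`, and insertion commutes with the push of `d`, or
    -- `c` is newer than all cells and is itself pushed. A `c` too old for the window still enters
    -- `L'`; the pushes then drop it.
    rcases lt_or_gt_of_ne (hc d (by simp)) with hlt | hgt
    · obtain ⟨L', h1, h2, h3⟩ := ih hL'.1 fun b hb => hc b (by simp [hb])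
      refine ⟨L' ++ [d], ?_, fun b => ?_, ?_⟩
      · rw [List.pairwise_append]
        refine ⟨h1, List.pairwise_singleton _ _, fun a ha b hb => ?_⟩
        rw [List.mem_singleton] at hb
        subst hb
        rcases (h2 a).1 ha with rfl | ha
        · exact hlt
        · exact hLd a ha
      · simp [h2, or_assoc]
      · simp only [List.foldl_append, List.foldl_cons, List.foldl_nil]
        rw [insertSorted_push _ _ _ hlt, h3]
    · have hle : ∀ b ∈ L ++ [d], b.ts < c.ts := by
        intro b hb
        rcases List.mem_append.1 hb with hb | hb
        · exact (hLd b hb).trans hgt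
        · rw [List.mem_singleton] at hb
          exact hb ▸ hgt
      refine ⟨L ++ [d] ++ [c], ?_, fun b => ?_, ?_⟩
      · rw [List.pairwise_append]
        refine ⟨hL, List.pairwise_singleton _ _, fun a ha b hb => ?_⟩
        rw [List.mem_singleton] at hb
        exact hb ▸ hle a ha
      · rw [List.mem_append, List.mem_singleton, or_comm]
      · rw [insertSorted_eq_push, List.foldl_append (l' := [c])]
        · rfl
        · exact ts_foldl_push_le _ c (fun b hb => (hle b hb).le) _ (ts_zeroCells_le c)

/-! ### Messages sent and received -/

namespace Execution

variable {n K : ℕ}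

/-- The messages that process `i` receives before step number `t`. -/
def received (ex : Execution n K) (i : Fin n) (t : ℕ) : Set ℕ :=
  {m | ∃ s < t, ReceivesAt ex.step i m s}

/-- The message broadcast at step number `m`. -/
def mess (ex : Execution n K) (k m : ℕ) : Option (Mess K) :=
  match ex.step m with
  | .call i (x, .write v) => some (((ex.config k m).loc i).writeMess i x v)
  | _ => none

theorem mess_of_write (ex : Execution n K) (k : ℕ) {m : ℕ} {i : Fin n} {x : Fin K} {v : ℕ}
    (h : ex.step m = .call i (x, .write v)) :
    ex.mess k m = some (((ex.config k m).loc i).writeMess i x v) := by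
  simp only [mess, h]

theorem exists_write_of_mess {ex : Execution n K} {k m : ℕ} {μ : Mess K}
    (h : ex.mess k m = some μ) : ∃ i x v, ex.step m = .call i (x, .write v) ∧
      μ = ((ex.config k m).loc i).writeMess i x v := by
  unfold mess at h
  split at h
  · rename_i i x v hs
    exact ⟨i, x, v, hs, (Option.some.inj h).symm⟩
  · cases h

theorem sent_config (ex : Execution n K) (k t m : ℕ) :
    (ex.config k t).sent m = if m < t then ex.mess k m else none := by
  induction t with
  | zero => rfl
  | succ t ih =>
    have hne : ∀ o : Option (Mess K), (m = t → ex.mess k t = none) →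
        o = (if m < t then ex.mess k m else none) →
        o = if m < t + 1 then ex.mess k m else none := by
      rintro o h rfl
      by_cases hmt : m = t
      · subst hmt
        simp [h rfl]
      · simp [show m < t + 1 ↔ m < t by omega]
    change ((ex.config k t).next t (ex.step t)).sent m = _
    match hs : ex.step t with
    | .idle => exact hne _ (fun _ => by simp [mess, hs]) ih
    | .crash i => exact hne _ (fun _ => by simp [mess, hs]) ih
    | .call i (x, .read) => exact hne _ (fun _ => by simp [mess, hs]) ih
    | .receive i m' =>
      refine hne _ (fun _ => by simp [mess, hs]) ?_
      rw [← ih]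
      simp only [Config.next]
      split <;> rfl
    | .call i (x, .write v) =>
      simp only [Config.next]
      by_cases hmt : m = t
      · subst hmt
        rw [Function.update_self, if_pos (Nat.lt_succ_self m), ex.mess_of_write k hs]
      · rw [Function.update_of_ne hmt, ih]
        simp [show m < t + 1 ↔ m < t by omega]

theorem exists_mess_of_broadcastsAt (ex : Execution n K) (k : ℕ) {i : Fin n} {m : ℕ}
    (h : BroadcastsAt ex.step i m) : ∃ μ, ex.mess k m = some μ := by
  obtain ⟨x, v, h⟩ := h
  exact ⟨_, ex.mess_of_write k h⟩

theorem le_of_receivesAt (ex : Execution n K) {i : Fin n} {m t : ℕ}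
    (h : ReceivesAt ex.step i m t) : m ≤ t := by
  rcases h with ⟨rfl, _⟩ | h
  · exact le_rfl
  · exact (ex.receive_broadcast i m t h).1.le

theorem lt_of_mem_received {ex : Execution n K} {i : Fin n} {m t : ℕ}
    (h : m ∈ ex.received i t) : m < t := by
  obtain ⟨s, hs, h⟩ := h
  exact (ex.le_of_receivesAt h).trans_lt hs

theorem received_mono (ex : Execution n K) (i : Fin n) {s t : ℕ} (h : s ≤ t) :
    ex.received i s ⊆ ex.received i t :=
  fun _ ⟨s', hs', hr⟩ => ⟨s', hs'.trans_le h, hr⟩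

theorem received_succ_of_receivesAt (ex : Execution n K) {i : Fin n} {m t : ℕ}
    (h : ReceivesAt ex.step i m t) (huniq : ∀ m', ReceivesAt ex.step i m' t → m' = m) :
    m ∉ ex.received i t ∧ ex.received i (t + 1) = insert m (ex.received i t) := by
  refine ⟨fun ⟨s, hs, hr⟩ => hs.ne (ex.receive_once i m s t hr h), ?_⟩
  ext m'
  constructor
  · rintro ⟨s, hs, hr⟩
    rcases Nat.lt_succ_iff_lt_or_eq.1 hs with hs | rfl
    · exact Or.inr ⟨s, hs, hr⟩
    · exact Or.inl (huniq m' hr)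
  · rintro (rfl | h')
    · exact ⟨t, Nat.lt_succ_self t, h⟩
    · exact ex.received_mono i (Nat.le_succ t) h'

theorem received_succ_of_not_receivesAt (ex : Execution n K) {i : Fin n} {t : ℕ}
    (h : ∀ m, ¬ ReceivesAt ex.step i m t) : ex.received i (t + 1) = ex.received i t := by
  refine subset_antisymm ?_ (ex.received_mono i (Nat.le_succ t))
  rintro m ⟨s, hs, hr⟩
  rcases Nat.lt_succ_iff_lt_or_eq.1 hs with hs | rfl
  · exact ⟨s, hs, hr⟩
  · exact absurd hr (h m)

/-- In each step, a process either keeps its state and receives nothing, or it receives a new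
message and updates its state accordingly. -/
theorem loc_succ (ex : Execution n K) (k : ℕ) (i : Fin n) (t : ℕ) :
    (ex.received i (t + 1) = ex.received i t ∧
      (ex.config k (t + 1)).loc i = (ex.config k t).loc i) ∨
    ∃ m μ, ex.mess k m = some μ ∧ m ∉ ex.received i t ∧
      ex.received i (t + 1) = insert m (ex.received i t) ∧
      (ex.config k (t + 1)).loc i = ((ex.config k t).loc i).onReceive μ := by
  have hc : ex.config k (t + 1) = (ex.config k t).next t (ex.step t) := rfl
  match hs : ex.step t with
  | .idle =>
    refine Or.inl ⟨ex.received_succ_of_not_receivesAt ?_, by rw [hc, hs]; rfl⟩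
    rintro m (⟨rfl, x, v, h⟩ | h) <;> simp [hs] at h
  | .crash j =>
    refine Or.inl ⟨ex.received_succ_of_not_receivesAt ?_, by rw [hc, hs]; rfl⟩
    rintro m (⟨rfl, x, v, h⟩ | h) <;> simp [hs] at h
  | .call j (x, .read) =>
    refine Or.inl ⟨ex.received_succ_of_not_receivesAt ?_, by rw [hc, hs]; rfl⟩
    rintro m (⟨rfl, x, v, h⟩ | h) <;> simp [hs] at h
  | .call j (x, .write v) =>
    by_cases hij : i = j
    · subst hij
      right
      have hr : ReceivesAt ex.step i t t := Or.inl ⟨rfl, x, v, hs⟩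
      refine ⟨t, _, ex.mess_of_write k hs, ?_⟩
      obtain ⟨h1, h2⟩ := ex.received_succ_of_receivesAt hr (by
        rintro m (⟨rfl, _⟩ | h)
        · rfl
        · simp [hs] at h)
      refine ⟨h1, h2, ?_⟩
      rw [hc, hs]
      exact Function.update_self ..
    · refine Or.inl ⟨ex.received_succ_of_not_receivesAt ?_, ?_⟩
      · rintro m (⟨rfl, x, v, h⟩ | h)
        · rw [hs] at h
          injection h with h
          exact hij h.symm
        · simp [hs] at h
      · rw [hc, hs]
        exact Function.update_of_ne hij ..
  | .receive j m =>
    obtain ⟨hmt, j', hb⟩ := ex.receive_broadcast j m t hs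
    obtain ⟨μ, hμ⟩ := ex.exists_mess_of_broadcastsAt k hb
    -- A message is received only after its broadcast, so the `none` branch of `Config.next` does
    -- not occur.
    have hsent : (ex.config k t).sent m = some μ := by rw [sent_config, if_pos hmt, hμ]
    have hloc : (ex.config k (t + 1)).loc
        = Function.update (ex.config k t).loc j (((ex.config k t).loc j).onReceive μ) := by
      rw [hc, hs]
      simp only [Config.next, hsent]
    rw [hloc]
    by_cases hij : i = j
    · subst hij
      right
      obtain ⟨h1, h2⟩ := ex.received_succ_of_receivesAt (Or.inr hs) (by
        rintro m' (⟨rfl, x, v, h⟩ | h)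
        · simp [hs] at h
        · rw [hs] at h
          injection h with _ h
          exact h.symm)
      exact ⟨m, μ, hμ, h1, h2, Function.update_self ..⟩
    · refine Or.inl ⟨ex.received_succ_of_not_receivesAt ?_, Function.update_of_ne hij ..⟩
      rintro m' (⟨rfl, x, v, h⟩ | h)
      · simp [hs] at h
      · rw [hs] at h
        injection h with h
        exact hij h.symm

/-! ### Lamport clocks and uniqueness of timestamps -/

/-- The clock of process `i` before step number `t`. -/
def clock (ex : Execution n K) (k : ℕ) (i : Fin n) (t : ℕ) : ℕ := ((ex.config k t).loc i).vtime

theorem vt_le_clock {ex : Execution n K} {k m : ℕ} {i : Fin n} {t : ℕ} {μ : Mess K}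
    (hm : m ∈ ex.received i t) (hμ : ex.mess k m = some μ) : μ.vt ≤ ex.clock k i t := by
  induction t with
  | zero =>
    obtain ⟨s, hs, _⟩ := hm
    omega
  | succ t ih =>
    rcases ex.loc_succ k i t with ⟨h1, h2⟩ | ⟨m', μ', hμ', _, h1, h2⟩
    · rw [h1] at hm
      rw [clock, h2]
      exact ih hm
    · rw [h1] at hm
      rw [clock, h2]
      rcases hm with rfl | hm
      · rw [hμ'] at hμ
        cases hμ
        exact le_max_right _ _
      · exact (ih hm).trans (le_max_left _ _)

theorem clock_eq_zero_or_exists (ex : Execution n K) (k : ℕ) (i : Fin n) (t : ℕ) :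
    ex.clock k i t = 0 ∨
      ∃ m ∈ ex.received i t, ∃ μ, ex.mess k m = some μ ∧ ex.clock k i t = μ.vt := by
  induction t with
  | zero => exact Or.inl rfl
  | succ t ih =>
    rcases ex.loc_succ k i t with ⟨h1, h2⟩ | ⟨m', μ', hμ', _, h1, h2⟩
    · rw [h1, clock, h2]
      exact ih
    · have hmax : ex.clock k i (t + 1) = max (ex.clock k i t) μ'.vt := by
        rw [clock, h2]
        rfl
      rw [h1, hmax]
      rcases le_total (ex.clock k i t) μ'.vt with hle | hle
      · exact Or.inr ⟨m', Or.inl rfl, μ', hμ', max_eq_right hle⟩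
      · rw [max_eq_left hle]
        exact ih.imp_right fun ⟨m, hm, h⟩ => ⟨m, Or.inr hm, h⟩

/-- The clock depends only on the set of received messages: it is their largest logical time, or
zero. -/
theorem clock_le_clock {ex : Execution n K} {i j : Fin n} {s t : ℕ} (k : ℕ)
    (h : ex.received i s ⊆ ex.received j t) : ex.clock k i s ≤ ex.clock k j t := by
  rcases ex.clock_eq_zero_or_exists k i s with h0 | ⟨m, hm, μ, hμ, heq⟩
  · omega
  · rw [heq]
    exact vt_le_clock (h hm) hμ

theorem clock_succ_of_write {ex : Execution n K} {m : ℕ} {i : Fin n} {x : Fin K} {v : ℕ} (k : ℕ)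
    (h : ex.step m = .call i (x, .write v)) : ex.clock k i (m + 1) = ex.clock k i m + 1 := by
  change (((ex.config k m).next m (ex.step m)).loc i).vtime = _
  simp only [h, Config.next, Function.update_self]
  exact max_eq_right (Nat.le_succ _)

theorem mess_of_write_eq {ex : Execution n K} {m : ℕ} {i : Fin n} {x : Fin K} {v : ℕ} (k : ℕ)
    (h : ex.step m = .call i (x, .write v)) :
    ex.mess k m = some ⟨x, v, ex.clock k i (m + 1), i⟩ := by
  rw [ex.mess_of_write k h, clock_succ_of_write k h]
  rfl

/-- Two writes with the same process identifier have the same author, whose clock never decreases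
and grows strictly at each write. -/
theorem mess_stamp_injective {ex : Execution n K} {k m m' : ℕ} {μ μ' : Mess K}
    (hμ : ex.mess k m = some μ) (hμ' : ex.mess k m' = some μ') (hvt : μ.vt = μ'.vt)
    (hj : μ.j = μ'.j) : m = m' := by
  obtain ⟨i, x, v, hs, rfl⟩ := exists_write_of_mess hμ
  obtain ⟨i', x', v', hs', rfl⟩ := exists_write_of_mess hμ'
  obtain rfl : i = i' := Fin.ext hj
  have hvt' : ex.clock k i m = ex.clock k i m' := Nat.succ_injective hvt
  by_contra hne
  rcases lt_or_gt_of_ne hne with hlt | hlt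
  · have := clock_succ_of_write k hs
    have := clock_le_clock k (ex.received_mono i (Nat.succ_le_of_lt hlt))
    simp only [Nat.succ_eq_add_one] at this
    omega
  · have := clock_succ_of_write k hs'
    have := clock_le_clock k (ex.received_mono i (Nat.succ_le_of_lt hlt))
    simp only [Nat.succ_eq_add_one] at this
    omega

/-! ### Contents of the local streams -/

/-- The cell that a message proposes. -/
def _root_.Mess.cell {K : ℕ} (μ : Mess K) : Cell := ⟨μ.v, toLex (μ.vt, μ.j)⟩

/-- The local streams hold the last received cells in the order of their timestamps. -/
theorem exists_str_eq_foldl_push (ex : Execution n K) (k : ℕ) (i : Fin n) (t : ℕ) (x : Fin K) :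
    ∃ L : List Cell, L.Pairwise (fun c d => c.ts < d.ts) ∧
      (∀ c, c ∈ L ↔ ∃ m ∈ ex.received i t, ∃ μ, ex.mess k m = some μ ∧ μ.x = x ∧ c = μ.cell) ∧
      ((ex.config k t).loc i).str x = L.foldl push (zeroCells k) := by
  induction t with
  | zero =>
    refine ⟨[], List.Pairwise.nil, fun c => ?_, rfl⟩
    simp [received]
  | succ t ih =>
    obtain ⟨L, hL, hmem, hstr⟩ := ih
    rcases ex.loc_succ k i t with ⟨h1, h2⟩ | ⟨m, μ, hμ, hm, h1, h2⟩
    · exact ⟨L, hL, by rwa [h1], by rw [h2, hstr]⟩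
    · by_cases hx : μ.x = x
      · subst hx
        obtain ⟨L', hL', hmem', hins⟩ := insertLoop_foldl_push μ.cell L hL (by
          rintro d hd heq
          obtain ⟨m', hm', μ', hμ', _, rfl⟩ := (hmem d).1 hd
          have h := congrArg ofLex heq
          simp only [Mess.cell, ofLex_toLex, Prod.mk.injEq] at h
          -- An equal timestamp in the stream would be that of the same message, which had not been
          -- received before.
          exact hm (mess_stamp_injective hμ hμ' h.1 h.2 ▸ hm'))
        refine ⟨L', hL', fun c => ?_, ?_⟩
        · rw [hmem', hmem, h1]
          constructor
          · rintro (rfl | ⟨m', hm', h⟩)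
            · exact ⟨m, Or.inl rfl, μ, hμ, rfl, rfl⟩
            · exact ⟨m', Or.inr hm', h⟩
          · rintro ⟨m', rfl | hm', μ', hμ', h⟩
            · rw [hμ] at hμ'
              cases hμ'
              exact Or.inl h.2
            · exact Or.inr ⟨m', hm', μ', hμ', h⟩
        · rw [h2, ← hins, ← hstr]
          exact Function.update_self ..
      · refine ⟨L, hL, fun c => ?_, ?_⟩
        · rw [hmem, h1]
          constructor
          · rintro ⟨m', hm', h⟩
            exact ⟨m', Or.inr hm', h⟩
          · rintro ⟨m', rfl | hm', μ', hμ', h⟩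
            · rw [hμ] at hμ'
              cases hμ'
              exact absurd h.1 hx
            · exact ⟨m', hm', μ', hμ', h⟩
        · rw [h2, ← hstr]
          exact Function.update_of_ne (Ne.symm hx) ..

/-! ### The causal order -/

theorem step_call (ex : Execution n K) (e : ex.Call) :
    ex.step e.1 = .call (ex.caller e) (ex.input e) := by
  have hcall : ∀ (s : SysStep n K) (h : s.call?.isSome),
      s = .call (s.call?.get h).1 (s.call?.get h).2 := by
    intro s h
    cases s <;> first | rfl | cases h
  exact hcall _ e.2

/-- The messages that the caller has received when a call ends. -/
def known (ex : Execution n K) (e : ex.Call) : Set ℕ := ex.received (ex.caller e) (e.1 + 1)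

/-- The causal order: `e'` occurs no earlier than `e`, and its caller has received all that the
caller of `e` had received. -/
def CausallyLe (ex : Execution n K) (e e' : ex.Call) : Prop :=
  e.1 ≤ e'.1 ∧ ex.known e ⊆ ex.known e'

theorem CausallyLe.refl {ex : Execution n K} (e : ex.Call) : ex.CausallyLe e e :=
  ⟨le_rfl, subset_rfl⟩

theorem CausallyLe.trans {ex : Execution n K} {a b c : ex.Call} (h : ex.CausallyLe a b)
    (h' : ex.CausallyLe b c) : ex.CausallyLe a c :=
  ⟨h.1.trans h'.1, h.2.trans h'.2⟩

/-- Reads broadcast nothing, so distinct calls may have the same received messages; step numbers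
separate them. -/
theorem CausallyLe.antisymm {ex : Execution n K} {a b : ex.Call} (h : ex.CausallyLe a b)
    (h' : ex.CausallyLe b a) : a = b :=
  Subtype.ext (le_antisymm h.1 h'.1)

theorem causallyLe_of_prog {ex : Execution n K} {e e' : ex.Call} (h : ex.caller e = ex.caller e')
    (h' : e.1 ≤ e'.1) : ex.CausallyLe e e' := by
  refine ⟨h', ?_⟩
  rw [known, known, h]
  exact ex.received_mono _ (Nat.succ_le_succ h')

/-- A call is eventually in the causal past of all the calls of a given process. -/
theorem exists_forall_causallyLe (ex : Execution n K) (e : ex.Call) (j : Fin n) :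
    ∃ N, ∀ e' : ex.Call, ex.caller e' = j → N ≤ e'.1 → ex.CausallyLe e e' := by
  by_cases hj : NonFaulty ex.step j
  · have hex : ∀ m, ∃ N, m ∈ ex.known e → m ∈ ex.received j N := by
      intro m
      by_cases hm : m ∈ ex.known e
      · obtain ⟨s, _, hr⟩ := hm
        obtain ⟨t, ht⟩ := ex.reliable _ m s hr j hj
        exact ⟨t + 1, fun _ => ⟨t, Nat.lt_succ_self t, ht⟩⟩
      · exact ⟨0, fun h => absurd h hm⟩
    choose N hN using hex
    -- The summand `e.1` gives the inequality of step numbers; the supremum suffices because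
    -- messages known to `e` have numbers at most `e.1`.
    refine ⟨e.1 + (Finset.range (e.1 + 1)).sup N, fun e' he' hle => ⟨by omega, fun m hm => ?_⟩⟩
    rw [known, he']
    have : N m ≤ (Finset.range (e.1 + 1)).sup N :=
      Finset.le_sup (Finset.mem_range.2 (lt_of_mem_received hm))
    exact ex.received_mono j (by omega) (hN m hm)
  -- A faulty process makes no call after its crash, so the claim is vacuous from there on.
  · simp only [NonFaulty, not_forall, not_not] at hj
    obtain ⟨s, hs⟩ := hj
    refine ⟨s + 1, fun e' he' hle => ?_⟩
    refine absurd ?_ (ex.crash_stops j s e'.1 hs hle)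
    rw [step_call, he']
    rfl

theorem finite_not_causallyLe (ex : Execution n K) (e : ex.Call) :
    {e' | ¬ ex.CausallyLe e e'}.Finite := by
  choose N hN using ex.exists_forall_causallyLe e
  refine ((Set.finite_Iio (Finset.univ.sup N)).preimage (f := fun c : ex.Call => c.1)
    Subtype.val_injective.injOn).subset fun e' h => ?_
  by_contra hlt
  have hlt : Finset.univ.sup N ≤ e'.1 := not_lt.1 hlt
  exact h (hN _ e' rfl ((Finset.le_sup (Finset.mem_univ _)).trans hlt))

theorem mem_known_self {ex : Execution n K} {e : ex.Call} {x : Fin K} {v : ℕ}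
    (h : ex.input e = (x, .write v)) : e.1 ∈ ex.known e :=
  ⟨e.1, Nat.lt_succ_self _, Or.inl ⟨rfl, x, v, by rw [step_call, h]⟩⟩

/-- A write is in the causal past of the calls whose caller has received its message. -/
theorem causallyLe_iff_mem_known {ex : Execution n K} {e e' : ex.Call} {x : Fin K} {v : ℕ}
    (h : ex.input e = (x, .write v)) : ex.CausallyLe e e' ↔ e.1 ∈ ex.known e' := by
  have hs : ex.step e.1 = .call (ex.caller e) (x, .write v) := by rw [step_call, h]
  refine ⟨fun h' => h'.2 (mem_known_self h), fun h' => ⟨?_, fun m hm => ?_⟩⟩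
  · exact Nat.lt_succ_iff.1 (lt_of_mem_received h')
  · obtain ⟨t, ht, hrt⟩ := h'
    obtain ⟨s, hse, hrs⟩ := hm
    rcases Nat.lt_succ_iff_lt_or_eq.1 hse with hse | rfl
    · obtain ⟨t', ht', hrt'⟩ := ex.causal _ e.1 m s ⟨x, v, hs⟩ hrs hse _ t hrt
      exact ⟨t', ht'.trans ht, hrt'⟩
    · rcases hrs with ⟨rfl, _⟩ | hrs
      · exact ⟨t, ht, hrt⟩
      · simp [hs] at hrs

/-! ### The total order -/

/-- The clock of the caller when a call ends. -/
def stamp (ex : Execution n K) (k : ℕ) (e : ex.Call) : ℕ := ex.clock k (ex.caller e) (e.1 + 1)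

/-- The sort key of the total order: writes are sorted by timestamp, and reads come after the writes
with the same logical time. -/
def key (ex : Execution n K) (k : ℕ) (e : ex.Call) : ℕ ×ₗ ℕ ×ₗ ℕ :=
  toLex (ex.stamp k e, toLex (match (ex.input e).2 with
    | .read => n
    | .write _ => (ex.caller e : ℕ), e.1))

theorem key_injective (ex : Execution n K) (k : ℕ) : Function.Injective (ex.key k) := by
  intro e e' h
  have h1 := congrArg (fun p => (ofLex (ofLex p).2).2) h
  exact Subtype.ext h1

/-- The only message received in the step of `e'` is its own, which is too recent to be known to
`e`. So all that `e` knows was received before the write, which then increments the clock. -/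
theorem stamp_lt_of_causallyLe_write {ex : Execution n K} {e e' : ex.Call} {x : Fin K} {v : ℕ}
    (k : ℕ) (h : ex.CausallyLe e e') (hne : e ≠ e') (hw : ex.input e' = (x, .write v)) :
    ex.stamp k e < ex.stamp k e' := by
  have hlt : e.1 < e'.1 := lt_of_le_of_ne h.1 fun hc => hne (Subtype.ext hc)
  have hs : ex.step e'.1 = .call (ex.caller e') (x, .write v) := by rw [step_call, hw]
  rw [stamp, stamp, clock_succ_of_write k hs, Nat.lt_succ_iff]
  apply clock_le_clock
  intro m hm
  obtain ⟨s, hse, hr⟩ := h.2 hm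
  rcases Nat.lt_succ_iff_lt_or_eq.1 hse with hse | rfl
  · exact ⟨s, hse, hr⟩
  · rcases hr with ⟨heq, _⟩ | hr
    · have := lt_of_mem_received hm
      omega
    · simp [hs] at hr

theorem key_le_of_causallyLe {ex : Execution n K} {e e' : ex.Call} (k : ℕ)
    (h : ex.CausallyLe e e') : ex.key k e ≤ ex.key k e' := by
  by_cases hne : e = e'
  · rw [hne]
  have hlt : e.1 < e'.1 := lt_of_le_of_ne h.1 fun hc => hne (Subtype.ext hc)
  rcases lt_or_eq_of_le (clock_le_clock k h.2) with hs | hs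
  · exact Prod.Lex.le_iff.2 (Or.inl hs)
  · refine Prod.Lex.le_iff.2 (Or.inr ⟨hs, ?_⟩)
    rcases hi : ex.input e' with ⟨x, _ | v⟩
    · refine (Prod.Lex.le_iff.2 ?_)
      simp only [key, ofLex_toLex, hi]
      -- At equal clocks `e'` is a read, with second component `n`: an earlier read is separated by
      -- step number, a write by its process identifier, which is below `n`.
      split
      · exact Or.inr ⟨rfl, hlt.le⟩
      · exact Or.inl (ex.caller e).isLt
    · exact absurd hs (stamp_lt_of_causallyLe_write k h hne hi).ne

/-! ### Reads return the replay of their causal past -/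

/-- The cell that a call proposes for the stream `x`. -/
def writtenCell (ex : Execution n K) (k : ℕ) (x : Fin K) (e : ex.Call) : Option Cell :=
  (writtenValue x (ex.input e)).map fun v => ⟨v, toLex (ex.stamp k e, ex.caller e)⟩

theorem writtenCell_eq_some_iff {ex : Execution n K} {k : ℕ} {x : Fin K} {e : ex.Call} {c : Cell} :
    ex.writtenCell k x e = some c ↔
      ∃ v, ex.input e = (x, .write v) ∧ ex.mess k e.1 = some ⟨x, v, ex.stamp k e, ex.caller e⟩ ∧
        c = ⟨v, toLex (ex.stamp k e, ex.caller e)⟩ := by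
  have hmess : ∀ v, ex.input e = (x, .write v) →
      ex.mess k e.1 = some ⟨x, v, ex.stamp k e, ex.caller e⟩ := fun v h =>
    mess_of_write_eq k (by rw [step_call, h])
  rcases hi : ex.input e with ⟨x', _ | v⟩
  · simp [writtenCell, hi, writtenValue]
  · by_cases hx : x' = x
    · subst hx
      simp [writtenCell, hi, writtenValue, hmess v hi, eq_comm]
    · simp [writtenCell, hi, writtenValue, hx]

theorem ts_lt_of_key_lt {ex : Execution n K} {k : ℕ} {x : Fin K} {e e' : ex.Call} {c c' : Cell}
    (h : ex.key k e < ex.key k e') (hc : ex.writtenCell k x e = some c)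
    (hc' : ex.writtenCell k x e' = some c') : c.ts < c'.ts := by
  obtain ⟨v, hi, hm, rfl⟩ := writtenCell_eq_some_iff.1 hc
  obtain ⟨v', hi', hm', rfl⟩ := writtenCell_eq_some_iff.1 hc'
  have hne : e.1 ≠ e'.1 := fun hc => h.ne (congrArg _ (Subtype.ext hc))
  simp only [key, hi, hi', Prod.Lex.lt_iff, ofLex_toLex] at h ⊢
  rcases h with h | ⟨h1, h | ⟨h2, _⟩⟩
  · exact Or.inl h
  · exact Or.inr ⟨h1, h⟩
  · exact absurd (mess_stamp_injective hm hm' h1 h2) hne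

/-- A call returns the output computed by the array of window streams after the rest of its causal
past, sorted by key. -/
theorem out_foldl_trans_eq_returnValue (ex : Execution n K) (k : ℕ) (e : ex.Call)
    (l : List ex.Call) (hl : l.Pairwise (fun a b => ex.key k a < ex.key k b))
    (hmem : ∀ e', e' ∈ l ↔ ex.CausallyLe e' e ∧ e' ≠ e) :
    ((windowStream k).array K).out
      ((l.map ex.input).foldl ((windowStream k).array K).trans ((windowStream k).array K).init)
      (ex.input e) = ((ex.config k e.1).loc (ex.caller e)).returnValue (ex.input e) := by
  rcases hi : ex.input e with ⟨x, _ | v⟩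
  swap
  · rfl
  obtain ⟨L, hL, hLmem, hstr⟩ := ex.exists_str_eq_foldl_push k (ex.caller e) e.1 x
  -- A read receives nothing, so it makes no difference whether messages are counted before or after
  -- its step.
  have hknown : ex.known e = ex.received (ex.caller e) e.1 := by
    refine ex.received_succ_of_not_receivesAt ?_
    rintro m (⟨rfl, x, v, h⟩ | h) <;> simp [step_call, hi] at h
  have hcells : l.filterMap (ex.writtenCell k x) = L := by
    have hsort : (l.filterMap (ex.writtenCell k x)).Pairwise (fun c d => c.ts < d.ts) :=
      List.pairwise_filterMap.2 (hl.imp fun h c hc c' hc' => ts_lt_of_key_lt h hc hc')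
    -- Two strictly sorted lists with the same elements are equal.
    refine List.Perm.eq_of_pairwise (fun a b _ _ h h' => absurd h h'.not_gt) hsort hL ?_
    refine (List.perm_ext_iff_of_nodup (hsort.imp fun h hc => h.ne (congrArg _ hc))
      (hL.imp fun h hc => h.ne (congrArg _ hc))).2 fun c => ?_
    rw [List.mem_filterMap, hLmem, ← hknown]
    constructor
    · rintro ⟨e', he', hc⟩
      obtain ⟨v, hi', hm, rfl⟩ := writtenCell_eq_some_iff.1 hc
      exact ⟨e'.1, (causallyLe_iff_mem_known hi').1 ((hmem e').1 he').1, _, hm, rfl, rfl⟩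
    · rintro ⟨m, hm, μ, hμ, rfl, rfl⟩
      obtain ⟨i, x, v, hs, rfl⟩ := exists_write_of_mess hμ
      let e' : ex.Call := ⟨m, by rw [hs]; rfl⟩
      have hs' := hs.symm.trans (ex.step_call e')
      injection hs' with hcaller hinput
      have hi' : ex.input e' = (x, .write v) := hinput.symm
      refine ⟨e', (hmem e').2 ⟨(causallyLe_iff_mem_known hi').2 hm, ?_⟩, ?_⟩
      · rintro hc
        rw [hc, hi] at hi'
        cases hi'
      · refine writtenCell_eq_some_iff.2 ⟨v, hi', mess_of_write_eq k (by rw [step_call, hi']; rfl), ?_⟩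
        have hstamp : ex.stamp k e' = ex.clock k i m + 1 := by
          rw [stamp, ← hcaller]
          exact clock_succ_of_write k hs
        rw [hstamp, ← hcaller]
        rfl
  have hvals : (l.map ex.input).filterMap (writtenValue x) = L.map Cell.val := by
    rw [← hcells, List.map_filterMap, List.filterMap_map]
    congr 1
    funext e'
    simp [writtenCell, Function.comp_def]
  change some (((l.map ex.input).foldl ((windowStream k).array K).trans
      ((windowStream k).array K).init) x) =
    some (fun y => (((ex.config k e.1).loc (ex.caller e)).str x y).val)
  rw [array_foldl_trans, hvals, hstr]
  exact congrArg some (comp_foldl_push Cell.val L (zeroCells k)).symm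

end Execution

theorem mainTheorem7 (n K k : ℕ) (H : History (Fin K × WInput) (Option (Fin k → ℕ)))
    (hH : AdmittedByAlgorithm n K k H) :
    H.CausallyConvergent ((windowStream k).array K) := by
  obtain ⟨ex, f, hlabel, hprog⟩ := hH
  let g : H.Event ≃ ex.Call := f
  refine History.causallyConvergent_of_sorted _ H (fun a b => ex.CausallyLe (g a) (g b))
    ⟨{ refl := fun _ => .refl _
       trans := fun _ _ _ h h' => h.trans h'
       antisymm := fun _ _ h h' => g.injective (h.antisymm h') }, fun a b h => ?_, fun a => ?_⟩
    (fun a => ex.key k (g a)) ((ex.key_injective k).comp g.injective)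
    (fun _ _ => Execution.key_le_of_causallyLe k) (fun a => ex.input (g a)) _
    (fun a => (hlabel a).symm) fun a l hl hmem => ?_
  · have h' := (hprog a b).2 h
    exact Execution.causallyLe_of_prog h'.1 h'.2
  · exact (ex.finite_not_causallyLe (g a)).preimage g.injective.injOn
  · refine Eq.trans ?_ (ex.out_foldl_trans_eq_returnValue k (g a) (l.map g) ?_ ?_)
    · rw [List.map_map, List.foldl_map]
      rfl
    · exact List.pairwise_map.2 hl
    · intro e'
      obtain ⟨b, rfl⟩ := g.surjective e'
      rw [List.mem_map_of_injective g.injective, hmem, g.injective.ne_iff]
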